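/- Let $M$ be a connected smooth manifold of dimension $n$. A Finsler metric on $M$ is a non-negative continuous function $F\colon TM\to\mathbb{R}$ that is smooth off the zero section, satisfies $F(tv)=tF(v)$ for all $t>0$ and $v\in TM$, vanishes exactly at the zero vectors, and is such that for every $p\in M$ the Hessian of the restriction of $E=F^2/2$ to $T_pM$ is positive definite at every non-zero $v\in T_pM$. The Finsler manifold $(M,F)$ is Riemannian if there is a smooth Riemannian metric $g$ on $M$ with $F(v)^2=g(v,v)$ for all $v\in TM$. A (smooth) linear connection $\nabla$ on $M$ is compatible with $F$ if its parallel transports preserve the Finslerian length of tangent vectors, i.e. $F$ is constant along every vector field that is parallel along a smooth curve. It is semi-symmetric if there is a smooth differential 1-form $\rho$ on $M$ such that its torsion is $T(X,Y)=\rho(Y)X-\rho(X)Y$ for all $X,Y$. **Theorem.** If $(M,F)$ is a non-Riemannian Finsler manifold, then $M$ admits at most one linear connection that is both compatible with $F$ and semi-symmetric. -/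

import Mathlib

open Bundle Set Filter
open scoped Manifold ContDiff Topology

noncomputable section

/-- A Finsler metric on a smooth `n`-dimensional manifold `M`: a non-negative continuous function
on the tangent bundle, smooth off the zero section, positively homogeneous and definite, such that
the fibrewise Hessian of the energy `F ^ 2 / 2` is positive definite at all non-zero vectors. -/
structure FinslerMetric (n : ℕ) (M : Type*) [TopologicalSpace M]
    [ChartedSpace (EuclideanSpace ℝ (Fin n)) M] [IsManifold (𝓡 n) ∞ M] where
  /-- The Finsler length of tangent vectors. -/
  toFun : TangentBundle (𝓡 n) M → ℝ
  nonneg : ∀ v, 0 ≤ toFun v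
  continuous : Continuous toFun
  smooth : ContMDiffOn (𝓡 n).tangent 𝓘(ℝ, ℝ) ∞ toFun {v | v.2 ≠ 0}
  homogeneous : ∀ (p : M) (v : TangentSpace (𝓡 n) p) (t : ℝ), 0 < t →
    toFun ⟨p, t • v⟩ = t * toFun ⟨p, v⟩
  definite : ∀ (p : M) (v : TangentSpace (𝓡 n) p), toFun ⟨p, v⟩ = 0 ↔ v = 0
  strongly_convex : ∀ (p : M) (v w : EuclideanSpace ℝ (Fin n)), v ≠ 0 → w ≠ 0 →
    0 < fderiv ℝ (fderiv ℝ fun u : EuclideanSpace ℝ (Fin n) => toFun ⟨p, u⟩ ^ 2 / 2) v w w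

section

variable {n : ℕ} {M : Type*} [TopologicalSpace M]
  [ChartedSpace (EuclideanSpace ℝ (Fin n)) M] [IsManifold (𝓡 n) ∞ M]

/-- The Finsler metric comes from a smooth Riemannian metric `g`: `F(v)² = g(v, v)`. -/
def FinslerMetric.IsRiemannian (F : FinslerMetric n M) : Prop :=
  ∃ g : ContMDiffRiemannianMetric (𝓡 n) ∞ (EuclideanSpace ℝ (Fin n))
      (fun p : M => TangentSpace (𝓡 n) p),
    ∀ (p : M) (v : TangentSpace (𝓡 n) p), F.toFun ⟨p, v⟩ ^ 2 = g.inner p v v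

variable (n M) in
/-- Linear connections (covariant derivatives) on the tangent bundle of `M`;
`cov Y p (X p)` is `(∇_X Y)(p)`. -/
abbrev LinearConnection : Type _ :=
  CovariantDerivative (𝓡 n) (EuclideanSpace ℝ (Fin n)) (TangentSpace (𝓡 n) : M → Type _)

/-- A vector field on `M` (not necessarily continuous) is differentiable at `p`. -/
def VectorFieldDifferentiableAt (X : (p : M) → TangentSpace (𝓡 n) p) (p : M) : Prop :=
  MDifferentiableAt (𝓡 n) (𝓡 n).tangent
    (fun q => (⟨q, X q⟩ : TangentBundle (𝓡 n) M)) p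

/-- The velocity `γ'(t)` of a curve `γ : [a, b] → M`. -/
def velocity (a b : ℝ) (γ : ℝ → M) (t : ℝ) : TangentSpace (𝓡 n) (γ t) :=
  mfderivWithin 𝓘(ℝ, ℝ) (𝓡 n) γ (Icc a b) t (1 : ℝ)

/-- `W` is the covariant derivative `(DV/dt)(t)` of the vector field `V` along the curve
`γ : [a, b] → M`: near `t`, the field is of the form `V(s) = ∑ⱼ cⱼ(s) Xⱼ(γ(s))` with vector fields
`Xⱼ` on `M` (for instance a local frame), and `W = ∑ⱼ (cⱼ'(t) Xⱼ(γ(t)) + cⱼ(t) ∇_{γ'(t)} Xⱼ)`.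
By the Leibniz rule, `W` does not depend on how `V` is written in this form. -/
def HasCovDerivAlongAt (cov : LinearConnection n M) (a b : ℝ) (γ : ℝ → M)
    (V : (t : ℝ) → TangentSpace (𝓡 n) (γ t)) (t : ℝ) (W : TangentSpace (𝓡 n) (γ t)) : Prop :=
  ∃ (m : ℕ) (c : Fin m → ℝ → ℝ) (c' : Fin m → ℝ) (X : Fin m → (p : M) → TangentSpace (𝓡 n) p),
    (∀ j, HasDerivWithinAt (c j) (c' j) (Icc a b) t) ∧
    (∀ j, VectorFieldDifferentiableAt (X j) (γ t)) ∧
    (∀ᶠ s in 𝓝[Icc a b] t, V s = ∑ j, c j s • X j (γ s)) ∧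
    W = ∑ j, (c' j • X j (γ t) + c j t • cov (X j) (γ t) (velocity a b γ t))

/-- `V` is a parallel vector field along the curve `γ : [a, b] → M`, so that `V(b)` is the parallel
transport of `V(a)` along `γ`. -/
def IsParallelAlong (cov : LinearConnection n M) (a b : ℝ) (γ : ℝ → M)
    (V : (t : ℝ) → TangentSpace (𝓡 n) (γ t)) : Prop :=
  ∀ t ∈ Icc a b, HasCovDerivAlongAt cov a b γ V t 0

/-- The connection is compatible with the Finsler metric: parallel transport along any smooth curve
preserves the Finslerian length of tangent vectors. -/
def IsCompatible (cov : LinearConnection n M) (F : FinslerMetric n M) : Prop :=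
  ∀ (a b : ℝ) (γ : ℝ → M), a < b → ContMDiffOn 𝓘(ℝ, ℝ) (𝓡 n) ∞ γ (Icc a b) →
    ∀ V : (t : ℝ) → TangentSpace (𝓡 n) (γ t), IsParallelAlong cov a b γ V →
      F.toFun ⟨γ b, V b⟩ = F.toFun ⟨γ a, V a⟩

/-- The connection is semi-symmetric: its torsion is `T(X, Y) = ρ(Y) X - ρ(X) Y` for a smooth
differential 1-form `ρ` on `M`. -/
def IsSemiSymmetric (cov : LinearConnection n M) : Prop :=
  ∃ ρ : (p : M) → TangentSpace (𝓡 n) p →L[ℝ] ℝ,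
    ContMDiff (𝓡 n) ((𝓡 n).prod 𝓘(ℝ, EuclideanSpace ℝ (Fin n) →L[ℝ] ℝ)) ∞
      (fun p => TotalSpace.mk' (EuclideanSpace ℝ (Fin n) →L[ℝ] ℝ)
        (E := fun p : M => TangentSpace (𝓡 n) p →L[ℝ] ℝ) p (ρ p)) ∧
    ∀ (p : M) (X Y : TangentSpace (𝓡 n) p), cov.torsion p X Y = ρ p Y • X - ρ p X • Y

end

end

/-! Let `A(v, ξ)` be the difference tensor of the two connections at `p`, with `v` the
differentiated vector and `ξ` the direction. Both connections keep `F` constant in their horizontal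
directions, so the derivative of `F` on the fibre kills `A(v, ξ)` at `v`
(`IsCompatible.fderiv_fiber_differenceTensor`): each `A(·, ξ)` is an infinitesimal linear isometry
of the norm `F_p`. The flow of such a map preserves the unit ball of `F_p`, hence Lebesgue measure
and the second moment of the ball, so all `A(·, ξ)` are skew for one inner product `g`
(`IsGauge.exists_invariant_inner`).

Semi-symmetry gives `A(Y, X) - A(X, Y) = ρ(Y) X - ρ(X) Y` with `ρ = ρ₁ - ρ₂`. As in the uniqueness
of the Levi-Civita connection, skewness and torsion force `A(v, X) = ρ(v) X - g(X, v) r`, where `r`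
is the `g`-dual of `ρ` (`eq_of_skew_of_torsion`).

In dimension at most one, or if `ρ = 0`, this is zero. Otherwise, where `ρ(v) ≠ 0`, the vectors
`A(v, X)` with `X` orthogonal to `v` fill the orthogonal complement of `v`. Hence `F_p² / g` is
constant on both sides of the hyperplane `ρ = 0`, and by continuity everywhere
(`IsGauge.eq_zero_or_exists_quadratic`). Parallel transport carries this Euclidean norm to every
point of the connected manifold (`IsCompatible.isEuclideanAt_of_isEuclideanAt`), so `F` is
Riemannian (`FinslerMetric.isRiemannian_of_isEuclideanAt`), a contradiction. -/

noncomputable section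

/-! ### Gauges on a vector space and their linear flows. -/

section PositivelyHomogeneous

variable {E : Type*} [NormedAddCommGroup E] [NormedSpace ℝ E] [FiniteDimensional ℝ E]

/-- A continuous, non-negative, positively homogeneous and definite function on a vector space. -/
structure IsGauge (f : E → ℝ) : Prop where
  continuous : Continuous f
  nonneg : ∀ v, 0 ≤ f v
  homogeneous : ∀ v (t : ℝ), 0 < t → f (t • v) = t * f v
  definite : ∀ v, f v = 0 ↔ v = 0

lemma exp_neg_mul_exp_self (T : E →L[ℝ] E) :
    NormedSpace.exp (-T) * NormedSpace.exp T = 1 := by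
  let _ : NormedAlgebra ℚ (E →L[ℝ] E) := NormedAlgebra.restrictScalars ℚ ℝ (E →L[ℝ] E)
  have : CompleteSpace E := FiniteDimensional.complete ℝ E
  rw [← NormedSpace.exp_add_of_commute ((Commute.refl T).neg_left)]
  simp

/-- Along the orbit `exp(tT) v` the derivative of `f` is `df(T ·) = 0`. The orbit of a non-zero
vector avoids the origin, where `f` need not be differentiable, because `exp(tT)` is invertible. -/
lemma apply_exp_smul_eq {f : E → ℝ} (hd : ∀ v ≠ 0, DifferentiableAt ℝ f v) (T : E →L[ℝ] E)
    (hT : ∀ v ≠ 0, fderiv ℝ f v (T v) = 0) (t : ℝ) (v : E) :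
    f (NormedSpace.exp (t • T) v) = f v := by
  rcases eq_or_ne v 0 with rfl | hv
  · simp
  have hne : ∀ s : ℝ, NormedSpace.exp (s • T) v ≠ 0 := by
    intro s h
    have h1 := exp_neg_mul_exp_self (s • T)
    have h2 : (NormedSpace.exp (-(s • T)) * NormedSpace.exp (s • T)) v = 0 := by
      rw [mul_apply_eq_comp, h, map_zero]
    rw [h1] at h2
    exact hv h2
  have hder : ∀ s : ℝ, HasDerivAt (fun s : ℝ => f (NormedSpace.exp (s • T) v)) 0 s := by
    intro s
    have h1 : HasDerivAt (fun s : ℝ => NormedSpace.exp (s • T))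
      (T * NormedSpace.exp (s • T)) s := hasDerivAt_exp_smul_const' T s
    have h2 : HasDerivAt (fun s : ℝ => NormedSpace.exp (s • T) v)
        (T (NormedSpace.exp (s • T) v)) s := by
      simpa using h1.clm_apply (hasDerivAt_const s v)
    have h3 := (hd _ (hne s)).hasFDerivAt.comp_hasDerivAt s h2
    rwa [hT _ (hne s)] at h3
  have := is_const_of_deriv_eq_zero (fun s => (hder s).differentiableAt)
    (fun s => (hder s).deriv) t 0
  simpa using this

namespace IsGauge

variable {f : E → ℝ}

lemma exists_le (hf : IsGauge f) : ∃ c > 0, ∀ v, c * ‖v‖ ≤ f v := by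
  -- In the zero space the unit sphere is empty and has no minimum.
  rcases subsingleton_or_nontrivial E with h | h
  · exact ⟨1, one_pos, fun v => by simpa [Subsingleton.elim v 0] using hf.nonneg 0⟩
  obtain ⟨u, hu, hmin⟩ := (isCompact_sphere (0 : E) 1).exists_isMinOn
    (NormedSpace.sphere_nonempty.2 zero_le_one) hf.continuous.continuousOn
  have hu0 : u ≠ 0 := by
    rintro rfl
    simp at hu
  refine ⟨f u, (hf.nonneg u).lt_of_ne fun h => hu0 ((hf.definite u).1 h.symm), fun v => ?_⟩
  rcases eq_or_ne v 0 with rfl | hv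
  · simpa using hf.nonneg 0
  have hv' : 0 < ‖v‖ := norm_pos_iff.2 hv
  have h1 : f u ≤ f (‖v‖⁻¹ • v) := hmin (by simp [norm_smul, hv'.ne'])
  rw [hf.homogeneous _ _ (inv_pos.2 hv')] at h1
  calc f u * ‖v‖ ≤ (‖v‖⁻¹ * f v) * ‖v‖ := by gcongr
    _ = f v := by field_simp

lemma isCompact_le_one (hf : IsGauge f) : IsCompact {v | f v ≤ 1} := by
  obtain ⟨c, hc, h⟩ := hf.exists_le
  refine (isCompact_closedBall (0 : E) c⁻¹).of_isClosed_subset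
    (isClosed_le hf.continuous continuous_const) fun v hv => ?_
  have := (h v).trans hv
  rw [mem_closedBall_zero_iff, ← one_div, le_div_iff₀ hc, mul_comm]
  exact this

omit [FiniteDimensional ℝ E] in
lemma exists_ball_subset (hf : IsGauge f) : ∃ r > 0, Metric.ball 0 r ⊆ {v | f v ≤ 1} := by
  have h : {v | f v < 1} ∈ 𝓝 (0 : E) := (isOpen_lt hf.continuous continuous_const).mem_nhds
    (by simp [(hf.definite 0).2 rfl])
  obtain ⟨r, hr, hr'⟩ := Metric.mem_nhds_iff.1 h
  exact ⟨r, hr, fun v hv => le_of_lt (show f v < 1 from hr' hv)⟩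

end IsGauge
end PositivelyHomogeneous

/-! ### The second moment of the unit ball of a gauge. -/

section Moment

open MeasureTheory

variable {E : Type*} [NormedAddCommGroup E] [NormedSpace ℝ E] [FiniteDimensional ℝ E]
  [MeasurableSpace E] [BorelSpace E] (μ : Measure E) [μ.IsAddHaarMeasure] {f : E → ℝ}

/-- A linear map scales Haar measure by a power of `|det|`. The unit ball of `f` is mapped to itself
and has finite positive measure, so the factor is 1. -/
lemma IsGauge.measurePreserving (hf : IsGauge f) (T : E ≃L[ℝ] E) (hT : ∀ v, f (T v) = f v) :
    MeasurePreserving T μ μ := by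
  refine ⟨T.continuous.measurable, ?_⟩
  have hdet : LinearMap.det (T : E →ₗ[ℝ] E) ≠ 0 := T.toLinearEquiv.isUnit_det'.ne_zero
  have hpre : (T : E →ₗ[ℝ] E) ⁻¹' {v | f v ≤ 1} = {v | f v ≤ 1} := by
    ext v
    simp [hT]
  have h1 := Measure.addHaar_preimage_linearMap μ hdet {v | f v ≤ 1}
  rw [hpre] at h1
  obtain ⟨r, hr, hr'⟩ := hf.exists_ball_subset
  have h0 : μ {v | f v ≤ 1} ≠ 0 :=
    ((Metric.measure_ball_pos μ 0 hr).trans_le (measure_mono hr')).ne'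
  have htop : μ {v | f v ≤ 1} ≠ ⊤ := hf.isCompact_le_one.measure_lt_top.ne
  have h2 : ENNReal.ofReal |(LinearMap.det (T : E →ₗ[ℝ] E))⁻¹| = 1 := by
    have : 1 * μ {v | f v ≤ 1} =
      ENNReal.ofReal |(LinearMap.det (T : E →ₗ[ℝ] E))⁻¹| * μ {v | f v ≤ 1} := by rwa [one_mul]
    exact ((ENNReal.mul_left_inj h0 htop).1 this).symm
  have h3 := Measure.map_linearMap_addHaar_eq_smul_addHaar μ hdet
  rw [h2, one_smul] at h3
  exact h3

lemma IsGauge.integrableOn (hf : IsGauge f) {F : Type*} [NormedAddCommGroup F] {ψ : E → F}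
    (hψ : Continuous ψ) : IntegrableOn ψ {v | f v ≤ 1} μ :=
  hψ.continuousOn.integrableOn_compact hf.isCompact_le_one

/-- The second moment of the unit ball, as a map from covectors to vectors. -/
def IsGauge.moment (hf : IsGauge f) : (E →L[ℝ] ℝ) →ₗ[ℝ] E where
  toFun α := ∫ v in {v | f v ≤ 1}, α v • v ∂μ
  map_add' α β := by
    simp only [add_apply, add_smul]
    exact integral_add (hf.integrableOn μ (by fun_prop)) (hf.integrableOn μ (by fun_prop))
  map_smul' c α := by
    simp only [smul_apply, smul_assoc]
    exact integral_smul c _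

lemma IsGauge.apply_moment (hf : IsGauge f) (α β : E →L[ℝ] ℝ) :
    β (hf.moment μ α) = ∫ v in {v | f v ≤ 1}, α v * β v ∂μ := by
  have : IntegrableOn (fun v => α v • v) {v | f v ≤ 1} μ := hf.integrableOn μ (by fun_prop)
  change β (∫ v in {v | f v ≤ 1}, α v • v ∂μ) = _
  rw [← ContinuousLinearMap.integral_comp_comm β this]
  simp

lemma IsGauge.apply_moment_comm (hf : IsGauge f) (α β : E →L[ℝ] ℝ) :
    β (hf.moment μ α) = α (hf.moment μ β) := by
  simp only [hf.apply_moment μ, mul_comm]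

lemma IsGauge.apply_moment_self_pos (hf : IsGauge f) {α : E →L[ℝ] ℝ} (hα : α ≠ 0) :
    0 < α (hf.moment μ α) := by
  rw [hf.apply_moment μ, setIntegral_pos_iff_support_of_nonneg_ae
    (Eventually.of_forall fun v => mul_self_nonneg _) (hf.integrableOn μ (by fun_prop))]
  obtain ⟨w, hw⟩ : ∃ w, α w ≠ 0 := by
    by_contra! h
    exact hα (ContinuousLinearMap.ext h)
  obtain ⟨r, hr, hr'⟩ := hf.exists_ball_subset
  have hopen : IsOpen (Metric.ball (0 : E) r ∩ {v | α v ≠ 0}) :=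
    Metric.isOpen_ball.inter (isOpen_ne_fun α.continuous continuous_const)
  have hne : (Metric.ball (0 : E) r ∩ {v | α v ≠ 0}).Nonempty := by
    have hw0 : 0 < ‖w‖ := norm_pos_iff.2 (by rintro rfl; simp at hw)
    -- This multiple of `w` has norm `r / 2`.
    refine ⟨(r / (2 * ‖w‖)) • w, ?_, ?_⟩
    · rw [mem_ball_zero_iff, norm_smul, Real.norm_of_nonneg (by positivity)]
      field_simp
      norm_num
    · have : r / (2 * ‖w‖) ≠ 0 := by positivity
      simp [hw, hr.ne', hw0.ne']
  refine (hopen.measure_pos μ hne).trans_le (measure_mono ?_)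
  rintro v ⟨hv, hv'⟩
  exact ⟨by simpa using hv', hr' hv⟩

/-- With `J` the moment map, `α(Jα)` is unchanged when `α` is replaced by `α ∘ exp(tT)`, since the
flow preserves both the ball and the measure. By symmetry of `J` its derivative at `t = 0` is `2
α(T(Jα))`. -/
lemma IsGauge.apply_comp_moment_eq_zero (hf : IsGauge f) (hd : ∀ v ≠ 0, DifferentiableAt ℝ f v)
    (T : E →L[ℝ] E) (hT : ∀ v ≠ 0, fderiv ℝ f v (T v) = 0) (α : E →L[ℝ] ℝ) :
    α (T (hf.moment μ α)) = 0 := by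
  let J : (E →L[ℝ] ℝ) →L[ℝ] E := LinearMap.toContinuousLinearMap (hf.moment μ)
  have hJ : ∀ β, J β = hf.moment μ β := fun β => rfl
  let a : ℝ → E →L[ℝ] ℝ := fun t => α.comp (NormedSpace.exp (t • T))
  have hinv : ∀ t, a t (J (a t)) = α (J α) := by
    intro t
    have h1 := exp_neg_mul_exp_self (t • T)
    have h2 : NormedSpace.exp (t • T) * NormedSpace.exp (-(t • T)) = 1 := by
      simpa using exp_neg_mul_exp_self (-(t • T))
    let e : E ≃L[ℝ] E := ContinuousLinearEquiv.equivOfInverse (NormedSpace.exp (t • T))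
      (NormedSpace.exp (-(t • T))) (fun v => congrArg (fun S : E →L[ℝ] E => S v) h1)
      (fun v => congrArg (fun S : E →L[ℝ] E => S v) h2)
    have he : ∀ v, e v = NormedSpace.exp (t • T) v := fun v => rfl
    have hfe : ∀ v, f (e v) = f v := fun v => apply_exp_smul_eq hd T hT t v
    have hpre : e ⁻¹' {v | f v ≤ 1} = {v | f v ≤ 1} := by
      ext v
      simp [hfe]
    have h3 := (hf.measurePreserving μ e hfe).setIntegral_preimage_emb
      e.toHomeomorph.measurableEmbedding (fun v => α v * α v) {v | f v ≤ 1}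
    rw [hpre] at h3
    rw [hJ, hJ, hf.apply_moment μ, hf.apply_moment μ, ← h3]
    rfl
  have hda : HasDerivAt a (α.comp T) 0 := by
    have h1 : HasDerivAt (fun s : ℝ => NormedSpace.exp (s • T))
      (T * NormedSpace.exp ((0 : ℝ) • T)) 0 := hasDerivAt_exp_smul_const' T 0
    have h2 := (hasDerivAt_const (0 : ℝ) α).clm_comp h1
    simpa [a] using h2
  have hdJ : HasDerivAt (fun t => J (a t)) (J (α.comp T)) 0 := J.hasFDerivAt.comp_hasDerivAt 0 hda
  have h4 := hda.clm_apply hdJ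
  have h5 : HasDerivAt (fun t => a t (J (a t))) 0 0 := by
    simp only [hinv]
    exact hasDerivAt_const _ _
  have h6 := h4.unique h5
  have ha0 : a 0 = α := by
    ext v
    simp [a]
  rw [ha0, hJ, hJ, hf.apply_moment_comm μ (α.comp T) α] at h6
  have h7 : (α.comp T) (hf.moment μ α) = α (T (hf.moment μ α)) := rfl
  linarith

end Moment

/-! ### The algebra on one tangent space: invariant inner product, torsion and the Euclidean
alternative. -/

section InvariantInnerProduct

variable {E : Type*} [NormedAddCommGroup E] [NormedSpace ℝ E] [FiniteDimensional ℝ E] {f : E → ℝ}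

open MeasureTheory in
/-- All linear vector fields along which the gauge `f` is constant are skew-symmetric with respect
to a common inner product. -/
lemma IsGauge.exists_invariant_inner (hf : IsGauge f) (hd : ∀ v ≠ 0, DifferentiableAt ℝ f v) :
    ∃ g : E →L[ℝ] E →L[ℝ] ℝ, (∀ v w, g v w = g w v) ∧ (∀ v ≠ 0, 0 < g v v) ∧
      (∀ ρ : E →L[ℝ] ℝ, ∃ r, ρ = g r) ∧
      ∀ T : E →L[ℝ] E, (∀ v ≠ 0, fderiv ℝ f v (T v) = 0) → ∀ v, g v (T v) = 0 := by
  let _ : MeasurableSpace E := borel E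
  have : BorelSpace E := ⟨rfl⟩
  let μ : Measure E := Measure.addHaar
  have hinj : Function.Injective (hf.moment μ) := by
    rw [injective_iff_map_eq_zero]
    intro α h
    by_contra hα
    have := hf.apply_moment_self_pos μ hα
    simp [h] at this
  have hdim : Module.finrank ℝ (E →L[ℝ] ℝ) = Module.finrank ℝ E := by
    rw [← (LinearMap.toContinuousLinearMap (𝕜 := ℝ) (E := E) (F' := ℝ)).finrank_eq]
    exact Subspace.dual_finrank_eq
  -- The moment is an inner product on covectors; its inverse is the required one on vectors.
  let e : (E →L[ℝ] ℝ) ≃ₗ[ℝ] E := LinearMap.linearEquivOfInjective (hf.moment μ) hinj hdim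
  have he : ∀ α, e α = hf.moment μ α := fun α => rfl
  have hsymm : ∀ v w, e.symm v w = e.symm w v := by
    intro v w
    obtain ⟨α, rfl⟩ := e.surjective v
    obtain ⟨β, rfl⟩ := e.surjective w
    rw [e.symm_apply_apply, e.symm_apply_apply, he, he]
    exact hf.apply_moment_comm μ β α
  refine ⟨LinearMap.toContinuousLinearMap e.symm.toLinearMap, hsymm, ?_, ?_, ?_⟩
  · intro v hv
    obtain ⟨α, rfl⟩ := e.surjective v
    rw [LinearMap.coe_toContinuousLinearMap', LinearEquiv.coe_coe, e.symm_apply_apply, he]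
    exact hf.apply_moment_self_pos μ (by rintro rfl; simp at hv)
  · intro ρ
    exact ⟨e ρ, by simp⟩
  · intro T hT v
    obtain ⟨α, rfl⟩ := e.surjective v
    rw [LinearMap.coe_toContinuousLinearMap', LinearEquiv.coe_coe, e.symm_apply_apply, he]
    exact hf.apply_comp_moment_eq_zero μ hd T hT α

omit [FiniteDimensional ℝ E] in
/-- A skew-symmetric tensor is determined by its torsion. -/
lemma eq_of_skew_of_torsion {g : E →L[ℝ] E →L[ℝ] ℝ} (hsymm : ∀ v w, g v w = g w v)
    (hpos : ∀ v ≠ 0, 0 < g v v) {A : E →L[ℝ] E →L[ℝ] E} (hskew : ∀ v X, g v (A v X) = 0)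
    {ρ : E →L[ℝ] ℝ} (htor : ∀ X Y, A Y X - A X Y = ρ Y • X - ρ X • Y) {r : E} (hr : ρ = g r)
    (v X : E) : A v X = ρ v • X - g X v • r := by
  -- `C` is the deviation of `A` from the expected solution. It is symmetric because the torsions
  -- agree, and still skew.
  let C : E → E → E := fun v X => A v X - ρ v • X + g X v • r
  have hC1 : ∀ v X, C v X = C X v := by
    intro v X
    have := htor X v
    have h2 : A v X - ρ v • X = A X v - ρ X • v := by
      rw [sub_eq_sub_iff_add_eq_add] at this ⊢
      rw [this]
      abel
    simp only [C, h2, hsymm X v]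
  have hC2 : ∀ v X, g v (C v X) = 0 := by
    intro v X
    simp only [C, map_add, map_sub, map_smul, smul_eq_mul, hskew, hr, hsymm v X, hsymm v r]
    ring
  have hadd : ∀ v w X, C (v + w) X = C v X + C w X := by
    intro v w X
    simp only [C, map_add, add_apply, add_smul]
    abel
  have hC3 : ∀ v w X, g v (C w X) = - g w (C v X) := by
    intro v w X
    have h := hC2 (v + w) X
    simp only [hadd, map_add, add_apply, hC2] at h
    linarith
  -- The form `g(w, C(v, X))` is symmetric in `v, X` and antisymmetric in `v, w`; alternating the
  -- two swaps three times each returns it with the opposite sign.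
  have hC4 : ∀ v w X, g w (C v X) = 0 := by
    intro v w X
    have h1 : g w (C v X) = - g w (C v X) := by
      calc g w (C v X) = - g v (C w X) := hC3 w v X
        _ = - g v (C X w) := by rw [hC1 w X]
        _ = g X (C v w) := by rw [hC3 v X w, neg_neg]
        _ = g X (C w v) := by rw [hC1 v w]
        _ = - g w (C X v) := hC3 X w v
        _ = - g w (C v X) := by rw [hC1 X v]
    linarith
  have h0 : C v X = 0 := by
    by_contra h
    exact (hpos _ h).ne' (hC4 _ _ _)
  have h1 : A v X - ρ v • X + g X v • r = 0 := h0
  rw [sub_add, sub_eq_zero] at h1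
  exact h1

omit [FiniteDimensional ℝ E] in
/-- A gauge whose derivative at each point `v` of the half-space `0 < σ` vanishes on the
`g`-orthogonal complement of `v` is there proportional to the norm of `g`. -/
lemma IsGauge.exists_sq_eq_of_pos (hf : IsGauge f) (hd : ∀ v ≠ 0, DifferentiableAt ℝ f v)
    {g : E →L[ℝ] E →L[ℝ] ℝ} (hsymm : ∀ v w, g v w = g w v) (hpos : ∀ v ≠ 0, 0 < g v v)
    (σ : E →L[ℝ] ℝ) (h : ∀ v w, 0 < σ v → g v w = 0 → fderiv ℝ f v w = 0) :
    ∃ c, ∀ v, 0 < σ v → f v ^ 2 = c * g v v := by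
  have hne : ∀ v, 0 < σ v → v ≠ 0 := by
    rintro v hv rfl
    simp at hv
  -- Euler's identity: differentiate `f(tv) = t f(v)` at `t = 1`.
  have heuler : ∀ v ≠ 0, fderiv ℝ f v v = f v := by
    intro v hv
    have h1 : HasDerivAt (fun t : ℝ => f (t • v)) (fderiv ℝ f v v) 1 := by
      have h2 : HasDerivAt (fun t : ℝ => t • v) v 1 := by
        simpa using (hasDerivAt_id (1 : ℝ)).smul_const v
      have h3 : HasFDerivAt f (fderiv ℝ f v) ((1 : ℝ) • v) := by
        simpa using (hd v hv).hasFDerivAt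
      exact h3.comp_hasDerivAt (1 : ℝ) h2
    have h4 : HasDerivAt (fun t : ℝ => f (t • v)) (f v) 1 := by
      have h5 : HasDerivAt (fun t : ℝ => t * f v) (f v) 1 := by
        simpa using (hasDerivAt_id (1 : ℝ)).mul_const (f v)
      refine h5.congr_of_eventuallyEq ?_
      filter_upwards [lt_mem_nhds zero_lt_one] with t ht using hf.homogeneous v t ht
    exact h1.unique h4
  have hopen : IsOpen {v | 0 < σ v} := isOpen_lt continuous_const σ.continuous
  -- The derivative of `f² / g` vanishes on the line of `v` by Euler's identity and on its
  -- orthogonal complement by `h`.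
  have hder : ∀ v, 0 < σ v → HasFDerivAt (fun v => f v ^ 2 * (g v v)⁻¹) (0 : E →L[ℝ] ℝ) v := by
    intro v hv
    have hg := (hpos v (hne v hv)).ne'
    have h1 := (hd v (hne v hv)).hasFDerivAt.pow 2
    have h2 : HasFDerivAt (fun v => g v v) (g v + g.flip v) v := by
      have := (g.hasFDerivAt (x := v)).clm_apply (hasFDerivAt_id (𝕜 := ℝ) v)
      simpa using this
    have h3 := h1.fun_mul
      (HasDerivAt.comp_hasFDerivAt (f := fun v => g v v) v (hasDerivAt_inv hg) h2)
    convert! h3 using 1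
    ext w
    obtain ⟨a, u, hu, rfl⟩ : ∃ (a : ℝ) (u : E), g v u = 0 ∧ w = a • v + u :=
      ⟨g v w / g v v, w - (g v w / g v v) • v, by simp [hg], by simp⟩
    simp [h v u hv hu, hu, hsymm u v, heuler v (hne v hv)]
    field_simp
    ring
  by_cases hn : ∃ v₀, 0 < σ v₀
  · obtain ⟨v₀, hv₀⟩ := hn
    refine ⟨f v₀ ^ 2 * (g v₀ v₀)⁻¹, fun v hv => ?_⟩
    have hconv : Convex ℝ {v | 0 < σ v} := convex_halfSpace_gt σ.isBoundedLinearMap.toIsLinearMap 0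
    have := hopen.is_const_of_fderiv_eq_zero hconv.isPreconnected
      (fun v hv => (hder v hv).differentiableAt.differentiableWithinAt)
      (fun v hv => (hder v hv).fderiv) hv hv₀
    rw [← this, inv_mul_cancel_right₀ (hpos v (hne v hv)).ne']
  · exact ⟨0, fun v hv => (hn ⟨v, hv⟩).elim⟩

/-- A tensor taking values in the infinitesimal isometries of a gauge, with torsion of
semi-symmetric type, vanishes unless the gauge is Euclidean. -/
theorem IsGauge.eq_zero_or_exists_quadratic (hf : IsGauge f)
    (hd : ∀ v ≠ 0, DifferentiableAt ℝ f v) (A : E →L[ℝ] E →L[ℝ] E) (ρ : E →L[ℝ] ℝ)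
    (hA : ∀ v ≠ 0, ∀ X, fderiv ℝ f v (A v X) = 0)
    (htor : ∀ X Y, A Y X - A X Y = ρ Y • X - ρ X • Y) :
    A = 0 ∨ ∃ B : E →L[ℝ] E →L[ℝ] ℝ, (∀ v w, B v w = B w v) ∧ ∀ v, f v ^ 2 = B v v := by
  obtain ⟨g, hsymm, hpos, hrep, hg⟩ := hf.exists_invariant_inner hd
  have hskew : ∀ v X, g v (A v X) = 0 := fun v X => hg (A.flip X) (fun v hv => hA v hv X) v
  obtain ⟨r, hr⟩ := hrep ρ
  have hform := eq_of_skew_of_torsion hsymm hpos hskew htor hr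
  -- If `ρ` has trivial kernel, the dimension is at most one; any two vectors are then proportional
  -- and `ρ(v) X = g(X, v) r`.
  by_cases hker : ∃ u ≠ 0, ρ u = 0
  swap
  · left
    push Not at hker
    have hz : ∀ v, ρ v = 0 → v = 0 := fun v hv => by_contra fun h => hker v h hv
    have hdim : ∀ v w, ρ v • w = ρ w • v := fun v w => by
      rw [← sub_eq_zero]
      exact hz _ (by simp [mul_comm])
    ext1 v
    ext1 X
    rw [hform]
    apply hz
    have h1 : g X v * ρ r = ρ v * ρ X := by
      have h2 := congrArg (g X) (hdim r v)
      simp only [map_smul, smul_eq_mul] at h2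
      rw [mul_comm, h2, hsymm X r, ← hr]
    simp [h1]
  by_cases hρ : ρ = 0
  · left
    have hr0 : r = 0 := by
      by_contra h
      have := hpos r h
      rw [← hr, hρ] at this
      simp at this
    ext1 v
    ext1 X
    rw [hform, hρ, hr0]
    simp
  right
  have hrr : 0 < ρ r := by
    rw [hr]
    exact hpos r (by rintro rfl; simp at hr; exact hρ hr)
  have hder : ∀ v w, ρ v ≠ 0 → g v w = 0 → fderiv ℝ f v w = 0 := by
    intro v w hv hw
    -- For `w` orthogonal to `v`, the choice `X = w / ρ(v)` gives `A(v, X) = w`.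
    have h1 := hA v (by rintro rfl; simp at hv) ((ρ v)⁻¹ • w)
    rwa [hform, map_smul, smul_apply, hsymm w v, hw, smul_zero, zero_smul, sub_zero,
      smul_inv_smul₀ hv] at h1
  obtain ⟨a, ha⟩ := hf.exists_sq_eq_of_pos hd hsymm hpos ρ fun v w hv => hder v w hv.ne'
  obtain ⟨b, hb⟩ := hf.exists_sq_eq_of_pos hd hsymm hpos (-ρ) fun v w hv =>
    hder v w (by rintro h; simp [h] at hv)
  -- The identity on a half-space extends to its boundary: approach `u` along `u + t s r`, with the
  -- sign of `s` choosing the side.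
  have hlim : ∀ (s k : ℝ), s ≠ 0 → (∀ v, 0 < s * ρ v → f v ^ 2 = k * g v v) →
      ∀ u, ρ u = 0 → f u ^ 2 = k * g u u := by
    intro s k hs hk u hu
    have hc1 : Continuous fun t : ℝ => f (u + (t * s) • r) ^ 2 := by
      have := hf.continuous
      fun_prop
    have hc2 : Continuous fun t : ℝ => k * g (u + (t * s) • r) (u + (t * s) • r) := by fun_prop
    have h1 : Tendsto (fun t : ℝ => f (u + (t * s) • r) ^ 2) (𝓝[>] 0) (𝓝 (f u ^ 2)) := by
      have := hc1.tendsto 0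
      simp only [zero_mul, zero_smul, add_zero] at this
      exact this.mono_left nhdsWithin_le_nhds
    have h2 : Tendsto (fun t : ℝ => k * g (u + (t * s) • r) (u + (t * s) • r)) (𝓝[>] 0)
        (𝓝 (k * g u u)) := by
      have := hc2.tendsto 0
      simp only [zero_mul, zero_smul, add_zero] at this
      exact this.mono_left nhdsWithin_le_nhds
    refine tendsto_nhds_unique (h1.congr' ?_) h2
    filter_upwards [self_mem_nhdsWithin] with t ht
    refine hk _ ?_
    have ht' : 0 < t := ht
    have : s * ρ (u + (t * s) • r) = t * s ^ 2 * ρ r := by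
      simp [hu]
      ring
    rw [this]
    positivity
  have ha' := hlim 1 a one_ne_zero (fun v hv => ha v (by simpa using hv))
  have hb' := hlim (-1) b (by norm_num) (fun v hv => hb v (by simpa using hv))
  obtain ⟨u, hu0, hu⟩ := hker
  -- The two half-spaces share the non-zero boundary vector `u`, which equates their constants.
  have hab : a = b := mul_right_cancel₀ (hpos u hu0).ne' ((ha' u hu).symm.trans (hb' u hu))
  refine ⟨a • g, fun v w => by simp [hsymm v w], fun v => ?_⟩
  rcases lt_trichotomy (ρ v) 0 with h | h | h
  · simpa [hab] using hb v (by simpa using h)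
  · simpa using ha' v h
  · simpa using ha v h

end InvariantInnerProduct

/-! ### Linear differential equations on the unit interval. -/

section LinearODE

variable {E : Type*} [NormedAddCommGroup E] [NormedSpace ℝ E] [CompleteSpace E]

/-- Existence of solutions of linear ordinary differential equations on `[0, 1]` with small
coefficients. -/
lemma exists_linear_ode_solution {B : ℝ → E →L[ℝ] E} (hB : ContinuousOn B (Icc 0 1))
    (hB' : ∀ t ∈ Icc (0 : ℝ) 1, ‖B t‖ ≤ 1 / 2) {t₀ : ℝ} (ht₀ : t₀ ∈ Icc (0 : ℝ) 1) (v : E) :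
    ∃ V : ℝ → E, V t₀ = v ∧ ∀ t ∈ Icc (0 : ℝ) 1, HasDerivWithinAt V (B t (V t)) (Icc 0 1) t := by
  -- On the ball of radius `‖v‖` about `v` one has `‖x‖ ≤ 2‖v‖`, so the bound `1 / 2` keeps the
  -- speed at most `‖v‖` and the solution stays in the ball for time 1.
  have hPL : IsPicardLindelof (fun t => B t) (⟨t₀, ht₀⟩ : Icc (0 : ℝ) 1) v ‖v‖₊ 0 ‖v‖₊ (1 / 2) := by
    refine ⟨fun t ht => ?_, fun x _ => hB.clm_apply continuousOn_const, fun t ht x hx => ?_, ?_⟩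
    · refine ((B t).lipschitz.weaken ?_).lipschitzOnWith
      have := hB' t ht
      rw [← NNReal.coe_le_coe]
      simpa using this
    · have h1 : ‖x‖ ≤ 2 * ‖v‖ := by
        have : ‖x - v‖ ≤ ‖v‖ := by simpa [dist_eq_norm] using hx
        have h2 := norm_add_le (x - v) v
        rw [sub_add_cancel] at h2
        linarith
      calc ‖B t x‖ ≤ ‖B t‖ * ‖x‖ := (B t).le_opNorm x
        _ ≤ 1 / 2 * (2 * ‖v‖) := by gcongr; exact hB' t ht
        _ = ‖v‖₊ := by simp
    · have : max (1 - t₀) (t₀ - 0) ≤ 1 := max_le (by linarith [ht₀.1]) (by linarith [ht₀.2])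
      simpa using mul_le_of_le_one_right (norm_nonneg v) this
  exact hPL.exists_eq_forall_mem_Icc_hasDerivWithinAt₀

end LinearODE

lemma continuousOn_sum_smulRight {F X ι : Type*} [NormedAddCommGroup F] [NormedSpace ℝ F]
    [TopologicalSpace X] [Fintype ι] (φ : ι → F →L[ℝ] ℝ) {L : ι → X → F →L[ℝ] F} {s : Set X}
    (hL : ∀ j, ContinuousOn (L j) s) : ContinuousOn (fun x => ∑ j, (φ j).smulRight (L j x)) s :=
  continuousOn_finsetSum _ fun j _ =>
    (ContinuousLinearMap.smulRightL ℝ F (F →L[ℝ] F) (φ j)).continuous.comp_continuousOn (hL j)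

/-! ### Finsler metrics and connections read in a chart. -/

section TangentCoordinates

variable {n : ℕ} {M : Type*} [TopologicalSpace M]
  [ChartedSpace (EuclideanSpace ℝ (Fin n)) M] [IsManifold (𝓡 n) ∞ M]

local notation "𝔼" => EuclideanSpace ℝ (Fin n)

/-- The tangent vector at `q` with components `v` in the chart at `p`. -/
def chartVector (p q : M) : 𝔼 →L[ℝ] TangentSpace (𝓡 n) q :=
  (trivializationAt 𝔼 (TangentSpace (𝓡 n) : M → Type _) p).symmL ℝ q

/-- The components of tangent vectors at `q` in the chart at `p`. -/
def chartComponents (p q : M) : TangentSpace (𝓡 n) q →L[ℝ] 𝔼 :=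
  (trivializationAt 𝔼 (TangentSpace (𝓡 n) : M → Type _) p).continuousLinearMapAt ℝ q

lemma chartVector_chartComponents {p q : M} (hq : q ∈ (chartAt 𝔼 p).source)
    (v : TangentSpace (𝓡 n) q) : chartVector p q (chartComponents p q v) = v :=
  Trivialization.symmL_continuousLinearMapAt _ hq v

lemma chartComponents_chartVector {p q : M} (hq : q ∈ (chartAt 𝔼 p).source) (v : 𝔼) :
    chartComponents p q (chartVector p q v) = v :=
  Trivialization.continuousLinearMapAt_symmL _ hq v

lemma chartComponents_self (p : M) (v : TangentSpace (𝓡 n) p) : chartComponents p p v = v := by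
  have h : chartComponents p p = mfderiv (𝓡 n) 𝓘(ℝ, 𝔼) (extChartAt (𝓡 n) p) p :=
    TangentBundle.continuousLinearMapAt_trivializationAt (mem_chart_source _ p)
  rw [h, mfderiv_extChartAt_self]
  rfl

lemma chartVector_self (p : M) (v : 𝔼) : chartVector p p v = v := by
  have h := chartComponents_chartVector (mem_chart_source 𝔼 p) v
  rwa [chartComponents_self] at h

omit [IsManifold (𝓡 n) ∞ M] in
lemma symm_mem_source {p : M} {x : 𝔼} (hx : x ∈ (extChartAt (𝓡 n) p).target) :
    (extChartAt (𝓡 n) p).symm x ∈ (chartAt 𝔼 p).source := by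
  simpa using (extChartAt (𝓡 n) p).map_target hx

lemma contMDiffOn_chartVector (p : M) :
    ContMDiffOn 𝓘(ℝ, 𝔼 × 𝔼) (𝓡 n).tangent ∞
      (fun z : 𝔼 × 𝔼 => (⟨(extChartAt (𝓡 n) p).symm z.1,
        chartVector p ((extChartAt (𝓡 n) p).symm z.1) z.2⟩ : TangentBundle (𝓡 n) M))
      ((extChartAt (𝓡 n) p).target ×ˢ univ) := by
  let e := trivializationAt 𝔼 (TangentSpace (𝓡 n) : M → Type _) p
  have h1 : ContMDiffOn ((𝓡 n).prod 𝓘(ℝ, 𝔼)) ((𝓡 n).prod 𝓘(ℝ, 𝔼)) ∞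
      e.toOpenPartialHomeomorph.symm e.target := e.contMDiffOn_symm
  have h2 : ContMDiffOn 𝓘(ℝ, 𝔼 × 𝔼) ((𝓡 n).prod 𝓘(ℝ, 𝔼)) ∞
      (fun z : 𝔼 × 𝔼 => ((extChartAt (𝓡 n) p).symm z.1, z.2))
      ((extChartAt (𝓡 n) p).target ×ˢ univ) := by
    refine ContMDiffOn.prodMk ?_ contDiff_snd.contMDiff.contMDiffOn
    exact (contMDiffOn_extChartAt_symm p).comp contDiff_fst.contMDiff.contMDiffOn
      fun z hz => hz.1
  have h3 : MapsTo (fun z : 𝔼 × 𝔼 => ((extChartAt (𝓡 n) p).symm z.1, z.2))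
      ((extChartAt (𝓡 n) p).target ×ˢ univ) e.target := by
    rintro z hz
    rw [e.mem_target]
    exact symm_mem_source hz.1
  refine (h1.comp h2 h3).congr fun z hz => ?_
  have h4 := e.mk_symm (symm_mem_source hz.1) z.2
  rw [← e.symmL_apply (R := ℝ) (symm_mem_source hz.1) z.2] at h4
  exact h4

variable (F : FinslerMetric n M)

/-- A Finsler metric in the chart at `p`. -/
def FinslerMetric.inChart (p : M) (z : 𝔼 × 𝔼) : ℝ :=
  F.toFun ⟨(extChartAt (𝓡 n) p).symm z.1, chartVector p ((extChartAt (𝓡 n) p).symm z.1) z.2⟩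

lemma chartVector_ne_zero {p q : M} (hq : q ∈ (chartAt 𝔼 p).source) {v : 𝔼} (hv : v ≠ 0) :
    chartVector p q v ≠ 0 := by
  intro h
  apply hv
  rw [← chartComponents_chartVector hq v, h, map_zero]

lemma FinslerMetric.contDiffOn_inChart (p : M) :
    ContDiffOn ℝ ∞ (F.inChart p) ((extChartAt (𝓡 n) p).target ×ˢ {0}ᶜ) := by
  rw [← contMDiffOn_iff_contDiffOn]
  refine F.smooth.comp ((contMDiffOn_chartVector p).mono (prod_mono_right (subset_univ _))) ?_
  intro z hz
  exact chartVector_ne_zero (symm_mem_source hz.1) hz.2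

lemma FinslerMetric.contDiffAt_inChart (p : M) {x v : 𝔼} (hx : x ∈ (extChartAt (𝓡 n) p).target)
    (hv : v ≠ 0) : ContDiffAt ℝ ∞ (F.inChart p) (x, v) :=
  (F.contDiffOn_inChart p).contDiffAt
    (((isOpen_extChartAt_target p).prod isOpen_compl_singleton).mem_nhds ⟨hx, hv⟩)

lemma FinslerMetric.inChart_self (p : M) (v : 𝔼) :
    F.inChart p (extChartAt (𝓡 n) p p, v) = F.toFun ⟨p, v⟩ := by
  have h : ∀ q, q = p → F.toFun ⟨q, chartVector p q v⟩ = F.toFun ⟨p, v⟩ := by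
    rintro q rfl
    rw [chartVector_self]
  exact h _ (extChartAt_to_inv p)

lemma FinslerMetric.inChart_extChartAt {p q : M}
    (hq : q ∈ (extChartAt (𝓡 n) p).source) (v : 𝔼) :
    F.inChart p (extChartAt (𝓡 n) p q, v) = F.toFun ⟨q, chartVector p q v⟩ := by
  have : ∀ q', q' = q → F.toFun ⟨q', chartVector p q' v⟩ = F.toFun ⟨q, chartVector p q v⟩ := by
    rintro _ rfl
    rfl
  exact this _ ((extChartAt (𝓡 n) p).left_inv hq)

lemma FinslerMetric.isGauge (p : M) : IsGauge fun v : 𝔼 => F.toFun ⟨p, v⟩ where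
  continuous := F.continuous.comp (FiberBundle.continuous_totalSpaceMk 𝔼 (TangentSpace (𝓡 n)) p)
  nonneg _ := F.nonneg _
  homogeneous v t ht := F.homogeneous p v t ht
  definite v := F.definite p v

lemma FinslerMetric.hasFDerivAt_fiber (p : M) {v : 𝔼} (hv : v ≠ 0) :
    HasFDerivAt (fun v : 𝔼 => F.toFun ⟨p, v⟩)
      ((fderiv ℝ (F.inChart p) (extChartAt (𝓡 n) p p, v)).comp (ContinuousLinearMap.inr ℝ 𝔼 𝔼))
      v := by
  have h1 := ((F.contDiffAt_inChart p (mem_extChartAt_target p) hv).differentiableAt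
    (by simp)).hasFDerivAt
  have h2 := h1.comp v (hasFDerivAt_prodMk_right (𝕜 := ℝ) (extChartAt (𝓡 n) p p) v)
  refine h2.congr_of_eventuallyEq (Eventually.of_forall fun w => ?_)
  exact (F.inChart_self p w).symm

variable [T2Space M]

/-- A smooth vector field on `M` which has constant components `v` in the chart at `p` near `p`. -/
def cutoffField (p : M) (v : 𝔼) (q : M) : TangentSpace (𝓡 n) q :=
  (Classical.arbitrary (SmoothBumpFunction (𝓡 n) p)) q • chartVector p q v

omit [T2Space M] in
lemma eventually_cutoffField_eq (p : M) :
    ∀ᶠ q in 𝓝 p, ∀ v : 𝔼, cutoffField p v q = chartVector p q v := by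
  filter_upwards [(Classical.arbitrary (SmoothBumpFunction (𝓡 n) p)).eventuallyEq_one] with q hq v
  simp [cutoffField, hq]

omit [T2Space M] in
lemma cutoffField_self (p : M) (v : 𝔼) : cutoffField p v p = v := by
  exact ((eventually_cutoffField_eq p).self_of_nhds v).trans (chartVector_self p v)

lemma contMDiff_cutoffField (p : M) (v : 𝔼) :
    ContMDiff (𝓡 n) (𝓡 n).tangent ∞
      (fun q => (⟨q, cutoffField p v q⟩ : TangentBundle (𝓡 n) M)) := by
  let ψ : SmoothBumpFunction (𝓡 n) p := Classical.arbitrary _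
  refine ContMDiffOn.smul_section_of_tsupport (u := (chartAt 𝔼 p).source)
    (s := fun q => chartVector p q v) ψ.contMDiff.contMDiffOn
    (chartAt 𝔼 p).open_source ψ.tsupport_subset_chartAt_source ?_
  let e := trivializationAt 𝔼 (TangentSpace (𝓡 n) : M → Type _) p
  refine (e.contMDiffOn_section_baseSet_iff).2 ?_
  refine (contMDiffOn_const (c := v)).congr fun q hq => ?_
  have := chartComponents_chartVector hq v
  exact (e.continuousLinearMapAt_apply_of_mem ℝ hq _).symm.trans this

/-- The Christoffel symbols of a linear connection in the chart at `p`, valid near `p`. -/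
def christoffel (cov : LinearConnection n M) (p : M) (x : 𝔼) : 𝔼 →L[ℝ] 𝔼 →L[ℝ] 𝔼 :=
  ∑ j, (EuclideanSpace.proj j : 𝔼 →L[ℝ] ℝ).smulRight
    ((chartComponents p ((extChartAt (𝓡 n) p).symm x)).comp
      ((cov (cutoffField p (EuclideanSpace.single j 1)) ((extChartAt (𝓡 n) p).symm x)).comp
        (chartVector p ((extChartAt (𝓡 n) p).symm x))))

omit [T2Space M] in
lemma christoffel_apply (cov : LinearConnection n M) (p : M) (x v ξ : 𝔼) :
    christoffel cov p x v ξ = ∑ j, v j • chartComponents p ((extChartAt (𝓡 n) p).symm x)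
      (cov (cutoffField p (EuclideanSpace.single j 1)) ((extChartAt (𝓡 n) p).symm x)
        (chartVector p ((extChartAt (𝓡 n) p).symm x) ξ)) := by
  simp only [christoffel, sum_apply]
  rfl

lemma continuousOn_christoffel (cov : LinearConnection n M)
    (hcov : CovariantDerivative.ContMDiffCovariantDerivative cov ∞) (p : M) :
    ContinuousOn (christoffel cov p) (extChartAt (𝓡 n) p).target := by
  unfold christoffel
  refine continuousOn_sum_smulRight _ fun j => ?_
  let e := trivializationAt (𝔼 →L[ℝ] 𝔼)
    (fun q : M => TangentSpace (𝓡 n) q →L[ℝ] TangentSpace (𝓡 n) q) p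
  let X := cutoffField (M := M) p (EuclideanSpace.single j 1)
  have h1 : Continuous fun q : M => (⟨q, cov X q⟩ : TotalSpace (𝔼 →L[ℝ] 𝔼)
      (fun q : M => TangentSpace (𝓡 n) q →L[ℝ] TangentSpace (𝓡 n) q)) := by
    have := hcov.contMDiff.contMDiff (σ := X) (contMDiff_cutoffField p _).contMDiffOn
    rw [contMDiffOn_univ] at this
    exact this.continuous
  -- The composite with chart components and chart vectors is exactly `∇X` read in the
  -- trivialization of the endomorphism bundle.
  change ContinuousOn (fun x : 𝔼 => (e ⟨(extChartAt (𝓡 n) p).symm x,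
      cov X ((extChartAt (𝓡 n) p).symm x)⟩).2) (extChartAt (𝓡 n) p).target
  refine continuous_snd.comp_continuousOn (e.continuousOn.comp
    (h1.comp_continuousOn (continuousOn_extChartAt_symm p)) fun x hx => ?_)
  exact ⟨symm_mem_source hx, symm_mem_source hx⟩

end TangentCoordinates

/-! ### Solvability of the transport equation along short rays. -/

section Rays

variable {E : Type*} [NormedAddCommGroup E] [NormedSpace ℝ E]

lemma add_smul_mem_ball {x ξ : E} {r t : ℝ} (hξ : ‖ξ‖ < r) (ht : t ∈ Icc (0 : ℝ) 1) :
    x + t • ξ ∈ Metric.ball x r := by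
  rw [Metric.mem_ball, dist_eq_norm, add_sub_cancel_left, norm_smul, Real.norm_of_nonneg ht.1]
  exact (mul_le_of_le_one_left (norm_nonneg _) ht.2).trans_lt hξ

set_option synthInstance.maxHeartbeats 400000 in
/-- The equation of parallel transport is solvable along short rays. -/
lemma exists_ray_solution [CompleteSpace E] {Γ : E → E →L[ℝ] E →L[ℝ] E} {x : E} {U : Set E}
    (hU : U ∈ 𝓝 x) (hΓ : ContinuousOn Γ U) :
    ∃ r > 0, Metric.ball x r ⊆ U ∧ ∀ ξ : E, ‖ξ‖ < r → ∀ t₀ ∈ Icc (0 : ℝ) 1, ∀ v : E,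
      ∃ V : ℝ → E, V t₀ = v ∧
        ∀ t ∈ Icc (0 : ℝ) 1, HasDerivWithinAt V (-Γ (x + t • ξ) (V t) ξ) (Icc 0 1) t := by
  have h0 : Tendsto (fun y => ‖Γ y‖) (𝓝 x) (𝓝 ‖Γ x‖) :=
    Tendsto.norm (E := E →L[ℝ] E →L[ℝ] E) (hΓ.continuousAt hU).tendsto
  have h1 : ∀ᶠ y in 𝓝 x, ‖Γ y‖ < ‖Γ x‖ + 1 := h0.eventually_lt_const (lt_add_one _)
  obtain ⟨r, hr, hball⟩ := Metric.eventually_nhds_iff_ball.1 (h1.and hU)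
  obtain ⟨C, hC⟩ : ∃ C, C = ‖Γ x‖ + 1 := ⟨_, rfl⟩
  have hC0 : 0 < C := by
    rw [hC]
    exact add_pos_of_nonneg_of_pos (ContinuousLinearMap.opNorm_nonneg _) one_pos
  rw [← hC] at hball
  -- As `‖Γ‖ ≤ C` near `x`, the bound `‖ξ‖ ≤ 1 / (2C)` makes the coefficient at most `1 / 2`, as
  -- `exists_linear_ode_solution` demands.
  refine ⟨min r (1 / (2 * C)), by positivity, fun y hy => (hball y
    (Metric.ball_subset_ball (min_le_left _ _) hy)).2, fun ξ hξ t₀ ht₀ v => ?_⟩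
  have hmem : ∀ t ∈ Icc (0 : ℝ) 1, x + t • ξ ∈ Metric.ball x r := fun t ht =>
    add_smul_mem_ball (hξ.trans_le (min_le_left _ _)) ht
  have hcont : ContinuousOn (fun t : ℝ => -(Γ (x + t • ξ)).flip ξ) (Icc 0 1) := by
    have h5 : ContinuousOn (fun t : ℝ => Γ (x + t • ξ)) (Icc 0 1) :=
      hΓ.comp (by fun_prop) fun t ht => (hball _ (hmem t ht)).2
    refine ContinuousOn.neg ?_
    exact ((ContinuousLinearMap.apply ℝ (E →L[ℝ] E) ξ).continuous.comp
      (ContinuousLinearMap.flipₗᵢ ℝ E E E).continuous).comp_continuousOn h5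
  have hbound : ∀ t ∈ Icc (0 : ℝ) 1, ‖-(Γ (x + t • ξ)).flip ξ‖ ≤ 1 / 2 := by
    intro t ht
    have h6 := (hball _ (hmem t ht)).1.le
    have h7 : ‖ξ‖ ≤ 1 / (2 * C) := (hξ.trans_le (min_le_right _ _)).le
    rw [norm_neg]
    calc ‖(Γ (x + t • ξ)).flip ξ‖
        ≤ ‖(Γ (x + t • ξ)).flip‖ * ‖ξ‖ := ContinuousLinearMap.le_opNorm _ _
      _ ≤ C * (1 / (2 * C)) := by
        rw [ContinuousLinearMap.opNorm_flip]
        exact mul_le_mul h6 h7 (norm_nonneg _) hC0.le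
      _ = 1 / 2 := by field_simp
  exact exists_linear_ode_solution hcont hbound ht₀ v

end Rays

/-! ### Parallel fields along straight lines of a chart. -/

section ChartLines

variable {n : ℕ} {M : Type*} [TopologicalSpace M]
  [ChartedSpace (EuclideanSpace ℝ (Fin n)) M] [IsManifold (𝓡 n) ∞ M]

local notation "𝔼" => EuclideanSpace ℝ (Fin n)

/-- The curve in `M` which is an affinely parametrised line in the chart at `p`. -/
def chartLine (p : M) (x ξ : 𝔼) (t : ℝ) : M := (extChartAt (𝓡 n) p).symm (x + t • ξ)

lemma hasDerivAt_line (x ξ : 𝔼) (t : ℝ) : HasDerivAt (fun t : ℝ => x + t • ξ) ξ t := by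
  simpa using ((hasDerivAt_id t).smul_const ξ).const_add x

lemma contMDiffOn_chartLine {p : M} {x ξ : 𝔼} {s : Set ℝ}
    (h : ∀ t ∈ s, x + t • ξ ∈ (extChartAt (𝓡 n) p).target) :
    ContMDiffOn 𝓘(ℝ, ℝ) (𝓡 n) ∞ (chartLine p x ξ) s := by
  have h1 : ContDiff ℝ ∞ fun t : ℝ => x + t • ξ := by fun_prop
  exact (contMDiffOn_extChartAt_symm p).comp h1.contMDiff.contMDiffOn h

lemma velocity_chartLine {p : M} {x ξ : 𝔼} {a b t : ℝ} (hab : a < b) (ht : t ∈ Icc a b)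
    (h : x + t • ξ ∈ (extChartAt (𝓡 n) p).target) :
    velocity a b (chartLine p x ξ) t = chartVector p (chartLine p x ξ t) ξ := by
  have hsrc : chartLine p x ξ t ∈ (chartAt 𝔼 p).source := symm_mem_source h
  have h1 : HasMFDerivWithinAt 𝓘(ℝ, ℝ) 𝓘(ℝ, 𝔼) (fun t : ℝ => x + t • ξ) (Icc a b) t
      (ContinuousLinearMap.toSpanSingleton ℝ ξ) :=
    (hasDerivAt_line x ξ t).hasFDerivAt.hasFDerivWithinAt.hasMFDerivWithinAt
  have h2 : HasMFDerivWithinAt 𝓘(ℝ, 𝔼) (𝓡 n) (extChartAt (𝓡 n) p).symm (range (𝓡 n)) (x + t • ξ)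
      (chartVector p (chartLine p x ξ t)) := by
    have h3 := (mdifferentiableWithinAt_extChartAt_symm h).hasMFDerivWithinAt
    have h4 : chartVector p (chartLine p x ξ t) = mfderivWithin 𝓘(ℝ, 𝔼) (𝓡 n)
      (extChartAt (𝓡 n) p).symm (range (𝓡 n)) (extChartAt (𝓡 n) p (chartLine p x ξ t)) :=
      TangentBundle.symmL_trivializationAt hsrc
    have h5 : extChartAt (𝓡 n) p (chartLine p x ξ t) = x + t • ξ :=
      (extChartAt (𝓡 n) p).right_inv h
    rw [h5] at h4
    rw [h4]
    exact h3
  have h6 := h2.comp t h1 (fun s _ => by simp)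
  have h7 := h6.mfderivWithin ((uniqueDiffOn_Icc hab t ht).uniqueMDiffWithinAt)
  unfold velocity
  have h8 : mfderivWithin 𝓘(ℝ, ℝ) (𝓡 n) (chartLine p x ξ) (Icc a b) t =
    (chartVector p (chartLine p x ξ t)).comp (ContinuousLinearMap.toSpanSingleton ℝ ξ) := h7
  rw [h8]
  change chartVector p (chartLine p x ξ t) ((1 : ℝ) • ξ) = _
  rw [one_smul]

variable [T2Space M]

/-- On the line the cutoff fields agree with the coordinate frame, so they can serve as the `Xⱼ` in
`HasCovDerivAlongAt`; the equation `V' = -Γ(V, ξ)` then says that the covariant derivative is zero.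
-/
lemma isParallelAlong_chartLine (cov : LinearConnection n M) {p : M} {x ξ : 𝔼} {a b : ℝ}
    (hab : a < b)
    (hline : ∀ t ∈ Icc a b, x + t • ξ ∈ (extChartAt (𝓡 n) p).target ∧
      ∀ v : 𝔼, cutoffField p v (chartLine p x ξ t) = chartVector p (chartLine p x ξ t) v)
    {V : ℝ → 𝔼}
    (hV : ∀ t ∈ Icc a b,
      HasDerivWithinAt V (-christoffel cov p (x + t • ξ) (V t) ξ) (Icc a b) t) :
    IsParallelAlong cov a b (chartLine p x ξ) fun t => chartVector p (chartLine p x ξ t) (V t) := by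
  intro t ht
  have hbasis : ∀ (q : M) (v : 𝔼), chartVector p q v =
      ∑ j, v j • chartVector p q (EuclideanSpace.single j 1) := by
    intro q v
    conv_lhs => rw [← (EuclideanSpace.basisFun (Fin n) ℝ).sum_repr v]
    simp
  have hsrc : chartLine p x ξ t ∈ (chartAt 𝔼 p).source := symm_mem_source (hline t ht).1
  refine ⟨n, fun j s => V s j, fun j => (-christoffel cov p (x + t • ξ) (V t) ξ) j,
    fun j => cutoffField p (EuclideanSpace.single j 1), fun j => ?_, fun j => ?_, ?_, ?_⟩
  · exact (EuclideanSpace.proj j : 𝔼 →L[ℝ] ℝ).hasFDerivAt.comp_hasDerivWithinAt t (hV t ht)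
  · exact (contMDiff_cutoffField p _).mdifferentiableAt (by simp)
  · filter_upwards [self_mem_nhdsWithin] with s hs
    simp only [(hline s hs).2]
    exact hbasis _ _
  · rw [Finset.sum_add_distrib]
    simp only [(hline t ht).2]
    have h1 := hbasis (chartLine p x ξ t) (-christoffel cov p (x + t • ξ) (V t) ξ)
    rw [velocity_chartLine hab ht (hline t ht).1, ← h1, map_neg, christoffel_apply, map_sum]
    simp only [map_smul]
    rw [eq_comm, neg_add_eq_zero]
    refine Finset.sum_congr rfl fun j _ => ?_
    congr 1
    exact chartVector_chartComponents hsrc _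

lemma IsCompatible.inChart_eq {cov : LinearConnection n M} {F : FinslerMetric n M}
    (h : IsCompatible cov F) {p : M} {x ξ : 𝔼} {a b : ℝ} (hab : a < b)
    (hline : ∀ t ∈ Icc a b, x + t • ξ ∈ (extChartAt (𝓡 n) p).target ∧
      ∀ v : 𝔼, cutoffField p v (chartLine p x ξ t) = chartVector p (chartLine p x ξ t) v)
    {V : ℝ → 𝔼}
    (hV : ∀ t ∈ Icc a b,
      HasDerivWithinAt V (-christoffel cov p (x + t • ξ) (V t) ξ) (Icc a b) t) :
    F.inChart p (x + b • ξ, V b) = F.inChart p (x + a • ξ, V a) :=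
  h a b _ hab (contMDiffOn_chartLine fun t ht => (hline t ht).1) _
    (isParallelAlong_chartLine cov hab hline hV)

/-- `V` represents a parallel vector field along the ray with direction `ξ` in the chart at `p`. -/
def IsParallelRay (cov : LinearConnection n M) (p : M) (ξ : 𝔼) (V : ℝ → 𝔼) : Prop :=
  ∀ t ∈ Icc (0 : ℝ) 1, HasDerivWithinAt V
    (-christoffel cov p (extChartAt (𝓡 n) p p + t • ξ) (V t) ξ) (Icc 0 1) t

/-- Near the centre of a chart, there are parallel vector fields along all rays, with prescribed
values at either end, and the Finsler metric is constant along them. -/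
lemma exists_parallel_rays {cov : LinearConnection n M} {F : FinslerMetric n M}
    (hcov : CovariantDerivative.ContMDiffCovariantDerivative cov ∞) (h : IsCompatible cov F)
    (p : M) : ∃ r > 0, ∀ ξ : 𝔼, ‖ξ‖ < r →
      (∀ t₀ ∈ Icc (0 : ℝ) 1, ∀ v : 𝔼, ∃ V : ℝ → 𝔼, V t₀ = v ∧ IsParallelRay cov p ξ V) ∧
      ∀ V, IsParallelRay cov p ξ V → ∀ t ∈ Icc (0 : ℝ) 1,
        F.inChart p (extChartAt (𝓡 n) p p + t • ξ, V t) = F.toFun ⟨p, V 0⟩ := by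
  have h2 : ∀ᶠ y in 𝓝 (extChartAt (𝓡 n) p p), ∀ v : 𝔼,
      cutoffField p v ((extChartAt (𝓡 n) p).symm y) =
        chartVector p ((extChartAt (𝓡 n) p).symm y) v := by
    have h4 := (continuousAt_extChartAt_symm (I := 𝓡 n) p).tendsto
    rw [extChartAt_to_inv] at h4
    exact h4.eventually (eventually_cutoffField_eq p)
  obtain ⟨r, hr, hball, hsol⟩ := exists_ray_solution
    (inter_mem (extChartAt_target_mem_nhds (I := 𝓡 n) p) h2)
    ((continuousOn_christoffel cov hcov p).mono inter_subset_left)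
  refine ⟨r, hr, fun ξ hξ => ⟨hsol ξ hξ, fun V hV t ht => ?_⟩⟩
  -- Compatibility speaks of intervals with `a < b`, so `t = 0` is separate.
  rcases ht.1.eq_or_lt with rfl | ht0
  · simpa using F.inChart_self p (V 0)
  have hsub : Icc 0 t ⊆ Icc (0 : ℝ) 1 := Icc_subset_Icc_right ht.2
  have := h.inChart_eq ht0 (fun s hs => hball (add_smul_mem_ball hξ (hsub hs)))
    (fun s hs => (hV s (hsub hs)).mono hsub)
  rw [this, zero_smul, add_zero, F.inChart_self]

end ChartLines

/-! ### Consequences of compatibility: horizontal constancy and linear isometries between tangent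
spaces. -/

section Compatible

variable {n : ℕ} {M : Type*} [TopologicalSpace M] [T2Space M]
  [ChartedSpace (EuclideanSpace ℝ (Fin n)) M] [IsManifold (𝓡 n) ∞ M]

local notation "𝔼" => EuclideanSpace ℝ (Fin n)

variable {cov : LinearConnection n M} {F : FinslerMetric n M}

/-- The Finsler metric is constant in horizontal directions of a compatible connection. -/
lemma IsCompatible.fderiv_inChart_horizontal
    (hcov : CovariantDerivative.ContMDiffCovariantDerivative cov ∞) (h : IsCompatible cov F)
    (p : M) {v : 𝔼} (hv : v ≠ 0) (ξ : 𝔼) :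
    fderiv ℝ (F.inChart p) (extChartAt (𝓡 n) p p, v)
      (ξ, -christoffel cov p (extChartAt (𝓡 n) p p) v ξ) = 0 := by
  obtain ⟨r, hr, hray⟩ := exists_parallel_rays hcov h p
  set x := extChartAt (𝓡 n) p p
  -- For short `ξ`, differentiate the constancy of `F` along a parallel field at `t = 0`. The claim
  -- is linear in `ξ`, so rescaling then covers all directions.
  have hsmall : ∀ ξ : 𝔼, ‖ξ‖ < r →
      fderiv ℝ (F.inChart p) (x, v) (ξ, -christoffel cov p x v ξ) = 0 := by
    intro ξ hξ
    obtain ⟨V, hV0, hV⟩ := (hray ξ hξ).1 0 (by simp) v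
    have h1 : HasDerivWithinAt (fun t : ℝ => (x + t • ξ, V t)) (ξ, -christoffel cov p x v ξ)
        (Icc 0 1) 0 := by
      refine (hasDerivAt_line x ξ 0).hasDerivWithinAt.prodMk ?_
      have h0 : HasDerivWithinAt V (-christoffel cov p (x + (0 : ℝ) • ξ) (V 0) ξ) (Icc 0 1) 0 :=
        hV 0 (by simp)
      rwa [zero_smul, add_zero, hV0] at h0
    have h2 : HasFDerivAt (F.inChart p) (fderiv ℝ (F.inChart p) (x, v))
        (x + (0 : ℝ) • ξ, V 0) := by
      rw [zero_smul, add_zero, hV0]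
      exact ((F.contDiffAt_inChart p (mem_extChartAt_target p) hv).differentiableAt
        (by simp)).hasFDerivAt
    have h3 := h2.comp_hasDerivWithinAt (0 : ℝ) h1
    have h4 : HasDerivWithinAt (F.inChart p ∘ fun t : ℝ => (x + t • ξ, V t)) 0 (Icc 0 1) 0 :=
      (hasDerivWithinAt_const (0 : ℝ) _ (F.toFun ⟨p, V 0⟩)).congr
        (fun t ht => (hray ξ hξ).2 V hV t ht) ((hray ξ hξ).2 V hV 0 (by simp))
    exact (uniqueDiffOn_Icc zero_lt_one 0 (by simp)).eq_deriv _ h3 h4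
  obtain ⟨c, hc0, hc⟩ : ∃ c : ℝ, c ≠ 0 ∧ ‖c • ξ‖ < r := by
    refine ⟨r / (2 * (‖ξ‖ + 1)), by positivity, ?_⟩
    rw [norm_smul, Real.norm_of_nonneg (by positivity)]
    have : ‖ξ‖ / (‖ξ‖ + 1) < 1 := by
      rw [div_lt_one (by positivity)]
      exact lt_add_one _
    calc r / (2 * (‖ξ‖ + 1)) * ‖ξ‖ = r / 2 * (‖ξ‖ / (‖ξ‖ + 1)) := by field_simp
      _ ≤ r / 2 * 1 := by gcongr
      _ < r := by linarith
  have h5 := hsmall _ hc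
  rw [map_smul, ← smul_neg, ← Prod.smul_mk, map_smul, smul_eq_zero] at h5
  exact h5.resolve_left hc0

/-- Parallel transport to the centre of a chart is a linear isometry of Finslerian length. -/
lemma IsCompatible.eventually_exists_linear_isometry
    (hcov : CovariantDerivative.ContMDiffCovariantDerivative cov ∞) (h : IsCompatible cov F)
    (p : M) : ∀ᶠ q in 𝓝 p, ∃ Φ : 𝔼 ≃L[ℝ] 𝔼, ∀ v : 𝔼, F.toFun ⟨q, v⟩ = F.toFun ⟨p, Φ v⟩ := by
  obtain ⟨r, hr, hray⟩ := exists_parallel_rays hcov h p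
  filter_upwards [extChartAt_source_mem_nhds (I := 𝓡 n) p,
    (continuousAt_extChartAt (I := 𝓡 n) p).eventually (Metric.ball_mem_nhds _ hr)] with q hq hqr
  have hq' : q ∈ (chartAt 𝔼 p).source := by simpa using hq
  obtain ⟨ξ, hξ⟩ : ∃ ξ, ξ = extChartAt (𝓡 n) p q - extChartAt (𝓡 n) p p := ⟨_, rfl⟩
  have hξr : ‖ξ‖ < r := by rwa [hξ, ← dist_eq_norm]
  have hend : extChartAt (𝓡 n) p p + (1 : ℝ) • ξ = extChartAt (𝓡 n) p q := by simp [hξ]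
  -- The basis vectors are prescribed at the far end `t = 1`, so the values at `t = 0` describe
  -- transport from `q` back to `p`.
  choose V hV1 hV using fun j : Fin n =>
    (hray ξ hξr).1 1 (by simp) (EuclideanSpace.single j (1 : ℝ))
  let S : 𝔼 →L[ℝ] 𝔼 := ∑ j, (EuclideanSpace.proj j : 𝔼 →L[ℝ] ℝ).smulRight (V j 0)
  have hS : ∀ w : 𝔼, S w = ∑ j, w j • V j 0 := fun w => by
    simp only [S, sum_apply]
    rfl
  let Φ : 𝔼 →ₗ[ℝ] 𝔼 := S.toLinearMap ∘ₗ (chartComponents p q).toLinearMap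
  have hΦ : ∀ v : 𝔼, F.toFun ⟨q, v⟩ = F.toFun ⟨p, Φ v⟩ := by
    intro v
    obtain ⟨w, hw⟩ : ∃ w, w = chartComponents p q v := ⟨_, rfl⟩
    have h1 : IsParallelRay cov p ξ fun t => ∑ j, w j • V j t := by
      intro t ht
      have h2 : -christoffel cov p (extChartAt (𝓡 n) p p + t • ξ) (∑ j, w j • V j t) ξ =
          ∑ j, w j • -christoffel cov p (extChartAt (𝓡 n) p p + t • ξ) (V j t) ξ := by
        rw [map_sum, sum_apply, ← Finset.sum_neg_distrib]
        simp
      rw [h2]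
      exact HasDerivWithinAt.fun_sum fun j _ => (hV j t ht).const_smul (w j)
    have h3 := (hray ξ hξr).2 _ h1 1 (by simp)
    have h4 : ∑ j, w j • V j 1 = w := by
      simp only [hV1]
      simpa using (EuclideanSpace.basisFun (Fin n) ℝ).sum_repr w
    rw [hend, h4] at h3
    have h6 : F.toFun ⟨q, chartVector p q w⟩ = F.toFun ⟨q, v⟩ := by
      rw [hw]
      exact congrArg (fun u : TangentSpace (𝓡 n) q => F.toFun ⟨q, u⟩)
        (chartVector_chartComponents hq' v)
    have h7 : Φ v = ∑ j, w j • V j 0 := by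
      rw [← hS, hw]
      rfl
    rw [h7, ← h3, F.inChart_extChartAt hq, h6]
  -- A length-preserving linear map is injective because `F` is definite.
  have hinj : Function.Injective Φ := by
    rw [injective_iff_map_eq_zero]
    intro v hv
    have h8 := hΦ v
    rw [hv] at h8
    exact (F.definite q v).1 (h8.trans ((F.definite p 0).2 rfl))
  exact ⟨(LinearEquiv.ofInjectiveEndo Φ hinj).toContinuousLinearEquiv, hΦ⟩

/-- The Finsler metric is the norm of an inner product on the tangent space at `p`. -/
def FinslerMetric.IsEuclideanAt (F : FinslerMetric n M) (p : M) : Prop :=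
  ∃ B : 𝔼 →L[ℝ] 𝔼 →L[ℝ] ℝ, (∀ v w, B v w = B w v) ∧ ∀ v : 𝔼, F.toFun ⟨p, v⟩ ^ 2 = B v v

omit [T2Space M] in
lemma FinslerMetric.IsEuclideanAt.of_linear {p q : M} (h : F.IsEuclideanAt p) (Φ : 𝔼 →L[ℝ] 𝔼)
    (hΦ : ∀ v : 𝔼, F.toFun ⟨q, v⟩ = F.toFun ⟨p, Φ v⟩) : F.IsEuclideanAt q := by
  obtain ⟨B, hsymm, hB⟩ := h
  exact ⟨B.bilinearComp Φ Φ, fun v w => hsymm _ _, fun v => by rw [hΦ, hB]; rfl⟩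

/-- The linear isometries between nearby tangent spaces make being Euclidean a locally constant
property, and `M` is connected. -/
lemma IsCompatible.isEuclideanAt_of_isEuclideanAt [ConnectedSpace M]
    (hcov : CovariantDerivative.ContMDiffCovariantDerivative cov ∞) (h : IsCompatible cov F)
    {p : M} (hp : F.IsEuclideanAt p) (q : M) : F.IsEuclideanAt q := by
  have hiff : ∀ p, ∀ᶠ q in 𝓝 p, F.IsEuclideanAt q ↔ F.IsEuclideanAt p := by
    intro p
    filter_upwards [h.eventually_exists_linear_isometry hcov p] with q hq
    obtain ⟨Φ, hΦ⟩ := hq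
    exact ⟨fun hq => hq.of_linear Φ.symm (by simp [hΦ]), fun hp => hp.of_linear Φ hΦ⟩
  have hclopen : IsClopen {q | F.IsEuclideanAt q} := by
    constructor
    · rw [← isOpen_compl_iff, isOpen_iff_eventually]
      intro p hp
      filter_upwards [hiff p] with q hq hq'
      exact hp (hq.1 hq')
    · rw [isOpen_iff_eventually]
      intro p hp
      filter_upwards [hiff p] with q hq using hq.2 hp
  exact eq_univ_iff_forall.1 (hclopen.eq_univ ⟨p, hp⟩) q

end Compatible

/-! ### A pointwise Euclidean Finsler metric is a smooth Riemannian metric. -/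

section Riemannian

/-- A map into a vector space is smooth if its components are. -/
lemma contMDiffAt_of_injective_linearMap {G ι : Type*} [NormedAddCommGroup G] [NormedSpace ℝ G]
    [Fintype ι] {E' H N : Type*} [NormedAddCommGroup E'] [NormedSpace ℝ E']
    [TopologicalSpace H] {I : ModelWithCorners ℝ E' H} [TopologicalSpace N] [ChartedSpace H N]
    {k : WithTop ℕ∞} {f : N → G} {p : N} (ev : G →ₗ[ℝ] ι → ℝ) (hev : ∀ L, ev L = 0 → L = 0)
    (hf : ∀ i, ContMDiffAt I 𝓘(ℝ, ℝ) k (fun q => ev (f q) i) p) :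
    ContMDiffAt I 𝓘(ℝ, G) k f p := by
  obtain ⟨R, hR⟩ := ev.exists_leftInverse_of_injective (LinearMap.ker_eq_bot'.2 hev)
  have h2 : ContMDiffAt I 𝓘(ℝ, ι → ℝ) k (fun q => ev (f q)) p := contMDiffAt_pi_space.2 hf
  have h3 := R.toContinuousLinearMap.contMDiff.contMDiffAt.comp p h2
  refine h3.congr_of_eventuallyEq (Eventually.of_forall fun q => ?_)
  exact (congrArg (fun S => S (f q)) hR).symm

/-- A map into bilinear forms is smooth if its values on all pairs of vectors are. -/
lemma contMDiffAt_bilinear {E : Type*} [NormedAddCommGroup E] [NormedSpace ℝ E]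
    [FiniteDimensional ℝ E] {E' H N : Type*} [NormedAddCommGroup E'] [NormedSpace ℝ E']
    [TopologicalSpace H] {I : ModelWithCorners ℝ E' H} [TopologicalSpace N] [ChartedSpace H N]
    {k : WithTop ℕ∞} {f : N → E →L[ℝ] E →L[ℝ] ℝ} {p : N}
    (hf : ∀ v w, ContMDiffAt I 𝓘(ℝ, ℝ) k (fun q => f q v w) p) :
    ContMDiffAt I 𝓘(ℝ, E →L[ℝ] E →L[ℝ] ℝ) k f p := by
  let b := Module.finBasis ℝ E
  refine contMDiffAt_of_injective_linearMap
    (ι := Fin (Module.finrank ℝ E) × Fin (Module.finrank ℝ E))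
    { toFun := fun L z => L (b z.1) (b z.2)
      map_add' := fun _ _ => rfl
      map_smul' := fun _ _ => rfl } (fun L hL => ?_) fun z => hf _ _
  have h1 : ∀ i, L (b i) = 0 := fun i => by
    refine ContinuousLinearMap.coe_injective (b.ext fun j => ?_)
    exact congrFun hL (i, j)
  exact ContinuousLinearMap.coe_injective (b.ext h1)

variable {n : ℕ} {M : Type*} [TopologicalSpace M]
  [ChartedSpace (EuclideanSpace ℝ (Fin n)) M] [IsManifold (𝓡 n) ∞ M]

local notation "𝔼" => EuclideanSpace ℝ (Fin n)

variable {F : FinslerMetric n M}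

lemma FinslerMetric.contMDiffAt_sq_chartVector (F : FinslerMetric n M) (p : M) (v : 𝔼) :
    ContMDiffAt (𝓡 n) 𝓘(ℝ, ℝ) ∞ (fun q => F.toFun ⟨q, chartVector p q v⟩ ^ 2) p := by
  -- `F` is smooth only off the zero section; on it `F²` is constantly zero.
  rcases eq_or_ne v 0 with rfl | hv
  · refine contMDiffAt_const.congr_of_eventuallyEq (f := fun _ => (0 : ℝ))
      (Eventually.of_forall fun q => ?_)
    simp [(F.definite q 0).2 rfl]
  have h1 : ContMDiffAt (𝓡 n) 𝓘(ℝ, ℝ) ∞ (fun q => F.inChart p (extChartAt (𝓡 n) p q, v)) p :=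
    ContMDiffAt.comp (f := fun q => (extChartAt (𝓡 n) p q, v)) p
      (F.contDiffAt_inChart p (mem_extChartAt_target p) hv).contMDiffAt
      (contMDiffAt_extChartAt.prodMk_space contMDiffAt_const)
  refine (h1.pow 2).congr_of_eventuallyEq ?_
  filter_upwards [extChartAt_source_mem_nhds (I := 𝓡 n) p] with q hq
  rw [F.inChart_extChartAt hq]

/-- The inner products are chosen point by point, yet polarization expresses them through `F²`, so
they inherit smoothness from `q ↦ F(v)²` with `v` of constant components in a chart. -/
theorem FinslerMetric.isRiemannian_of_isEuclideanAt (h : ∀ p, F.IsEuclideanAt p) :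
    F.IsRiemannian := by
  choose B hsymm hB using h
  let g : (p : M) → TangentSpace (𝓡 n) p →L[ℝ] TangentSpace (𝓡 n) p →L[ℝ] ℝ := B
  have hgsymm : ∀ (p : M) (v w : TangentSpace (𝓡 n) p), g p v w = g p w v := hsymm
  have hg : ∀ (p : M) (v : TangentSpace (𝓡 n) p), F.toFun ⟨p, v⟩ ^ 2 = g p v v := hB
  have hpolar : ∀ (p : M) (v w : TangentSpace (𝓡 n) p), g p v w =
      (F.toFun ⟨p, v + w⟩ ^ 2 - F.toFun ⟨p, v⟩ ^ 2 - F.toFun ⟨p, w⟩ ^ 2) * 2⁻¹ := by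
    intro p v w
    rw [hg, hg, hg]
    simp only [map_add, add_apply, hgsymm p w v]
    ring
  refine ⟨⟨g, hgsymm, fun p v hv => ?_, fun p => ?_, fun p => ?_⟩, hg⟩
  · rw [← hg]
    have := (F.nonneg ⟨p, v⟩).lt_of_ne fun h => hv ((F.definite p v).1 h.symm)
    positivity
  -- The unit ball of `g` is that of `F`, which lies in the ball of radius `1 / c`.
  · obtain ⟨c, hc, hle⟩ := (F.isGauge p).exists_le
    have : Bornology.IsVonNBounded ℝ {v : 𝔼 | B p v v < 1} := by
      refine (NormedSpace.isVonNBounded_closedBall ℝ 𝔼 c⁻¹).subset fun v hv => ?_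
      have hv' : B p v v < 1 := hv
      rw [← hB, sq_lt_one_iff₀ (F.nonneg _)] at hv'
      rw [mem_closedBall_zero_iff, ← one_div, le_div_iff₀ hc, mul_comm]
      exact (hle v).trans hv'.le
    exact this
  · rw [contMDiffAt_hom_bundle]
    refine ⟨contMDiffAt_id, contMDiffAt_bilinear fun v w => ?_⟩
    have h1 : ContMDiffAt (𝓡 n) 𝓘(ℝ, ℝ) ∞ (fun q =>
        (F.toFun ⟨q, chartVector p q (v + w)⟩ ^ 2 - F.toFun ⟨q, chartVector p q v⟩ ^ 2 -
          F.toFun ⟨q, chartVector p q w⟩ ^ 2) * 2⁻¹) p :=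
      (((F.contMDiffAt_sq_chartVector p (v + w)).sub (F.contMDiffAt_sq_chartVector p v)).sub
        (F.contMDiffAt_sq_chartVector p w)).mul contMDiffAt_const
    refine h1.congr_of_eventuallyEq ?_
    filter_upwards [(chartAt 𝔼 p).open_source.mem_nhds (mem_chart_source 𝔼 p)] with q hq
    rw [map_add]
    refine Eq.trans ?_ (hpolar q (chartVector p q v) (chartVector p q w))
    have h2 := inCoordinates_apply_eq₂ (𝕜 := ℝ) (F₁ := 𝔼) (F₂ := 𝔼) (F₃ := ℝ)
      (E₁ := (TangentSpace (𝓡 n) : M → Type _)) (E₂ := (TangentSpace (𝓡 n) : M → Type _))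
      (E₃ := Bundle.Trivial M ℝ) (x₀ := p) (x := q) (ϕ := g q) (v := v) (w := w) hq hq (mem_univ q)
    refine h2.trans ?_
    have h3 : ∀ y : ℝ, (trivializationAt ℝ (Bundle.Trivial M ℝ) p).linearMapAt ℝ q y = y := by
      simp
    refine (h3 _).trans ?_
    unfold chartVector
    rw [Trivialization.symmL_apply _ hq, Trivialization.symmL_apply _ hq]

end Riemannian

/-! ### The difference tensor of two connections. -/

section Uniqueness

variable {n : ℕ} {M : Type*} [TopologicalSpace M] [T2Space M]
  [ChartedSpace (EuclideanSpace ℝ (Fin n)) M] [IsManifold (𝓡 n) ∞ M]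

local notation "𝔼" => EuclideanSpace ℝ (Fin n)

/-- The covariant derivative of a vector field at a point, in the standard coordinates of the
tangent space. -/
def covariantDerivAt (cov : LinearConnection n M) (X : (p : M) → TangentSpace (𝓡 n) p) (p : M) :
    𝔼 →L[ℝ] 𝔼 := cov X p

omit [T2Space M] in
lemma christoffel_self (cov : LinearConnection n M) (p : M) (v ξ : 𝔼) :
    christoffel cov p (extChartAt (𝓡 n) p p) v ξ =
      ∑ j, v j • covariantDerivAt cov (cutoffField p (EuclideanSpace.single j 1)) p ξ := by
  rw [christoffel_apply]
  refine Finset.sum_congr rfl fun j _ => congrArg (v j • ·) ?_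
  have : ∀ q, q = p → chartComponents p q
      (cov (cutoffField p (EuclideanSpace.single j 1)) q (chartVector p q ξ)) =
      covariantDerivAt cov (cutoffField p (EuclideanSpace.single j 1)) p ξ := by
    rintro q rfl
    rw [chartComponents_self, chartVector_self]
    rfl
  exact this _ (extChartAt_to_inv p)

/-- The torsion of a linear connection at a point, in the standard coordinates of the tangent
space. -/
def torsionAt (cov : LinearConnection n M) (p : M) : 𝔼 →L[ℝ] 𝔼 →L[ℝ] 𝔼 := cov.torsion p

variable (cov₁ cov₂ : LinearConnection n M)

/-- The difference tensor of two linear connections at a point. -/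
def differenceTensor (p : M) : 𝔼 →L[ℝ] 𝔼 →L[ℝ] 𝔼 :=
  cov₁.difference cov₂ p

variable {cov₁ cov₂}

omit [T2Space M] in
lemma differenceTensor_apply {p : M} {X : (p : M) → TangentSpace (𝓡 n) p} {v : 𝔼}
    (hX : VectorFieldDifferentiableAt X p) (hv : X p = v) :
    differenceTensor cov₁ cov₂ p v = covariantDerivAt cov₁ X p - covariantDerivAt cov₂ X p := by
  subst hv
  exact IsCovariantDerivativeOn.difference_apply
    cov₁.isCovariantDerivativeOnUniv cov₂.isCovariantDerivativeOnUniv (mem_univ p) hX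

lemma differenceTensor_eq_christoffel_sub (p : M) (v ξ : 𝔼) :
    differenceTensor cov₁ cov₂ p v ξ = christoffel cov₁ p (extChartAt (𝓡 n) p p) v ξ -
      christoffel cov₂ p (extChartAt (𝓡 n) p p) v ξ := by
  rw [christoffel_self, christoffel_self, ← Finset.sum_sub_distrib]
  conv_lhs => rw [← (EuclideanSpace.basisFun (Fin n) ℝ).sum_repr v]
  rw [map_sum, sum_apply]
  refine Finset.sum_congr rfl fun j _ => ?_
  rw [map_smul, smul_apply, EuclideanSpace.basisFun_apply, differenceTensor_apply
    ((contMDiff_cutoffField p (EuclideanSpace.single j (1 : ℝ))).mdifferentiableAt (by simp))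
    (cutoffField_self p _), sub_apply, smul_sub]
  simp

-- Extend `X` and `Y` to fields: the Lie bracket enters both torsions equally and cancels.
omit [T2Space M] in
lemma differenceTensor_sub_flip (p : M) (X Y : 𝔼) :
    differenceTensor cov₁ cov₂ p Y X - differenceTensor cov₁ cov₂ p X Y =
      torsionAt cov₁ p X Y - torsionAt cov₂ p X Y := by
  let e (Z : 𝔼) : (q : M) → TangentSpace (𝓡 n) q :=
    FiberBundle.extend 𝔼 (E := (TangentSpace (𝓡 n) : M → Type _)) (x := p) Z
  have hd : ∀ Z : 𝔼, VectorFieldDifferentiableAt (e Z) p :=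
    fun Z => FiberBundle.mdifferentiableAt_extend (𝓡 n) 𝔼 _
  have he : ∀ Z : 𝔼, e Z p = Z := fun Z => FiberBundle.extend_apply_self 𝔼 _
  let b : 𝔼 := VectorField.mlieBracket (𝓡 n) (e X) (e Y) p
  have htor : ∀ cov : LinearConnection n M, torsionAt cov p X Y =
      covariantDerivAt cov (e Y) p X - covariantDerivAt cov (e X) p Y - b := by
    intro cov
    have h := cov.torsion_apply (hd X) (hd Y)
    rw [he, he] at h
    exact h
  rw [htor, htor, differenceTensor_apply (hd Y) (he Y), differenceTensor_apply (hd X) (he X),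
    sub_apply, sub_apply]
  abel

/-- The horizontal lifts `(ξ, -Γᵢ(v, ξ))` for both connections are killed by `dF`; their difference
is vertical, with fibre part the difference tensor. -/
lemma IsCompatible.fderiv_fiber_differenceTensor {F : FinslerMetric n M}
    (hcov₁ : CovariantDerivative.ContMDiffCovariantDerivative cov₁ ∞)
    (hcov₂ : CovariantDerivative.ContMDiffCovariantDerivative cov₂ ∞)
    (h₁ : IsCompatible cov₁ F) (h₂ : IsCompatible cov₂ F) (p : M) {v : 𝔼} (hv : v ≠ 0) (ξ : 𝔼) :
    fderiv ℝ (fun v : 𝔼 => F.toFun ⟨p, v⟩) v (differenceTensor cov₁ cov₂ p v ξ) = 0 := by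
  rw [(F.hasFDerivAt_fiber p hv).fderiv, differenceTensor_eq_christoffel_sub]
  have h := (h₂.fderiv_inChart_horizontal hcov₂ p hv ξ).trans
    (h₁.fderiv_inChart_horizontal hcov₁ p hv ξ).symm
  rw [← sub_eq_zero, ← map_sub] at h
  simpa [sub_eq_add_neg, add_comm] using h

end Uniqueness

end

theorem theorem1 {n : ℕ} {M : Type*} [TopologicalSpace M] [T2Space M]
    [SecondCountableTopology M] [ConnectedSpace M]
    [ChartedSpace (EuclideanSpace ℝ (Fin n)) M] [IsManifold (𝓡 n) ∞ M]
    (F : FinslerMetric n M) (hF : ¬ F.IsRiemannian)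
    (cov₁ cov₂ : LinearConnection n M)
    (smooth₁ : CovariantDerivative.ContMDiffCovariantDerivative cov₁ ∞)
    (smooth₂ : CovariantDerivative.ContMDiffCovariantDerivative cov₂ ∞)
    (compatible₁ : IsCompatible cov₁ F) (compatible₂ : IsCompatible cov₂ F)
    (semiSymmetric₁ : IsSemiSymmetric cov₁) (semiSymmetric₂ : IsSemiSymmetric cov₂)
    (X : (p : M) → TangentSpace (𝓡 n) p) (p : M) (hX : VectorFieldDifferentiableAt X p) :
    cov₁ X p = cov₂ X p := by
  obtain ⟨ρ₁, -, hρ₁⟩ := semiSymmetric₁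
  obtain ⟨ρ₂, -, hρ₂⟩ := semiSymmetric₂
  let r₁ : EuclideanSpace ℝ (Fin n) →L[ℝ] ℝ := ρ₁ p
  let r₂ : EuclideanSpace ℝ (Fin n) →L[ℝ] ℝ := ρ₂ p
  -- The two 1-forms may differ; the antisymmetric part of the difference tensor is again of
  -- semi-symmetric type, with form `ρ₁ - ρ₂`.
  have htor : ∀ X Y, differenceTensor cov₁ cov₂ p Y X - differenceTensor cov₁ cov₂ p X Y =
      (r₁ - r₂) Y • X - (r₁ - r₂) X • Y := by
    intro X Y
    have h₁ : torsionAt cov₁ p X Y = r₁ Y • X - r₁ X • Y := hρ₁ p X Y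
    have h₂ : torsionAt cov₂ p X Y = r₂ Y • X - r₂ X • Y := hρ₂ p X Y
    rw [differenceTensor_sub_flip, h₁, h₂]
    simp only [sub_apply, sub_smul]
    abel
  rcases (F.isGauge p).eq_zero_or_exists_quadratic
    (fun v hv => (F.hasFDerivAt_fiber p hv).differentiableAt)
    (differenceTensor cov₁ cov₂ p) (r₁ - r₂)
    (fun v hv ξ => compatible₁.fderiv_fiber_differenceTensor smooth₁ smooth₂ compatible₂ p hv ξ)
    htor with h | h
  · have h0 := differenceTensor_apply (cov₁ := cov₁) (cov₂ := cov₂) hX rfl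
    rw [h] at h0
    exact sub_eq_zero.1 h0.symm
  · exact (hF (F.isRiemannian_of_isEuclideanAt
      (compatible₁.isEuclideanAt_of_isEuclideanAt smooth₁ h))).elim
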